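/- Let $\alpha\in(0,2)$, $\mathsf a>1$, $C_u>0$ and $K>0$. There is a constant $C>0$, depending only on $\alpha,\mathsf a,C_u,K$, such that for all $C_\ell,T_0>0$ there is a constant $M>0$, depending only on $\alpha,\mathsf a,C_u,K,C_\ell,T_0$, with the following property. Let $n\ge 1$, $N=\lceil \mathsf a\,n\rceil$, and let $X=(x_{ij})$ be an $N\times n$ random matrix with i.i.d. real entries satisfying $$C_\ell\, t^{-\alpha}\le \mathbb P\{|x_{11}|>t\}\le C_u\, t^{-\alpha}\qquad\text{for all } t\ge T_0 .$$ Then the smallest singular value $s_{\min}(X)$ satisfies $$\mathbb P\Big\{ s_{\min}(X)\ge C\,N^{\frac1\alpha}(\log N)^{\frac{\alpha-2}{2\alpha}}\Big\}\le M\,N^{-K}.$$ That is, $s_{\min}(X)<C N^{1/\alpha}(\log N)^{(\alpha-2)/(2\alpha)}$ with probability $1-O(N^{-K})$. -/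

import Mathlib

open MeasureTheory ProbabilityTheory

/-- `X` is an `N × n` heavy-tailed random matrix with aspect ratio `a` and tail exponent `α`:
`N = ⌈a n⌉`, the entries are i.i.d. real random variables, and each entry `x` satisfies
`Cl t^(-α) ≤ P(|x| > t) ≤ Cu t^(-α)` for all `t ≥ T₀`. -/
structure IsHeavyTailedMatrix {Ω : Type*} [MeasurableSpace Ω] (μ : Measure Ω)
    (a α Cl Cu T₀ : ℝ) {N n : ℕ} (X : Ω → Matrix (Fin N) (Fin n) ℝ) : Prop where
  rows : N = ⌈a * (n : ℝ)⌉₊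
  measurable : ∀ i j, Measurable (fun ω => X ω i j)
  indep : iIndepFun (fun (p : Fin N × Fin n) (ω : Ω) => X ω p.1 p.2) μ
  identDistrib : ∀ i j i' j', IdentDistrib (fun ω => X ω i j) (fun ω => X ω i' j') μ μ
  tail : ∀ i j, ∀ t : ℝ, T₀ ≤ t →
    Cl * t ^ (-α) ≤ μ.real {ω | t < |X ω i j|} ∧ μ.real {ω | t < |X ω i j|} ≤ Cu * t ^ (-α)

/-- The smallest singular value of an `N × n` real matrix (`1 ≤ n`): the last of the `n` square
roots of the eigenvalues of `Aᵀ A`, listed in descending order (Mathlib's list starts at `0`). -/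
noncomputable def smallestSingularValue {N n : ℕ} (A : Matrix (Fin N) (Fin n) ℝ) : ℝ :=
  (Matrix.toEuclideanLin A).singularValues (n - 1)

/-! The smallest singular value is at most the norm of every column, so it suffices that some column
is atypically short. Truncate at the level `τ` with `Cu * τ ^ (-α) = log N / (8 * N)`. A column has
all entries within `τ` with probability at least about `N ^ (-1/4)`, and on that event its squared
norm has mean of order `N * τ ^ (2 - α)`, which is of order `N ^ (2/α) * (log N) ^ ((α - 2)/α)`, the
square of the target. Markov's inequality on this event makes a column short with probability at
least `N ^ (-1/4) / 2` (`exp_div_two_le_measureReal_sum_sq_lt`). The columns are independent, so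
none is short with probability at most `exp (-n * N ^ (-1/4) / 2)`, which beats every power of `N`.
-/

/-- The squared column norm is the Rayleigh quotient of `AᵀA` at a basis vector, an average of
eigenvalues with weights summing to 1. -/
theorem sq_smallestSingularValue_le_column {N n : ℕ} (A : Matrix (Fin N) (Fin n) ℝ) (j : Fin n) :
    smallestSingularValue A ^ 2 ≤ ∑ i, A i j ^ 2 := by
  have hn : 0 < n := j.pos
  set T := Matrix.toEuclideanLin A with hT
  have hfr : Module.finrank ℝ (EuclideanSpace ℝ (Fin n)) = n := by simp
  have hlt : n - 1 < n := by omega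
  set hs := T.isSymmetric_adjoint_comp_self
  set b := hs.eigenvectorBasis hfr
  set e : EuclideanSpace ℝ (Fin n) := EuclideanSpace.single j 1 with he
  have hsv : smallestSingularValue A ^ 2 = hs.eigenvalues hfr ⟨n - 1, hlt⟩ :=
    T.sq_singularValues_of_lt hfr hlt
  have hcol : ∑ i, A i j ^ 2 = inner ℝ ((LinearMap.adjoint T ∘ₗ T) e) e := by
    rw [LinearMap.comp_apply, LinearMap.adjoint_inner_left, real_inner_self_eq_norm_sq,
      EuclideanSpace.norm_sq_eq]
    simp [hT, he]
  have hsum : inner ℝ ((LinearMap.adjoint T ∘ₗ T) e) e =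
      ∑ i, hs.eigenvalues hfr i * b.repr e i ^ 2 := by
    rw [← b.repr.inner_map_map, PiLp.inner_apply]
    refine Finset.sum_congr rfl fun i _ => ?_
    rw [hs.eigenvectorBasis_apply_self_apply hfr]
    simp [b]
    ring
  have hone : ∑ i, b.repr e i ^ 2 = 1 := by
    have := EuclideanSpace.norm_sq_eq (b.repr e)
    rw [LinearIsometryEquiv.norm_map] at this
    simpa [he] using this.symm
  rw [hsv, hcol, hsum, ← mul_one (hs.eigenvalues hfr _), ← hone, Finset.mul_sum]
  refine Finset.sum_le_sum fun i _ => mul_le_mul_of_nonneg_right ?_ (sq_nonneg _)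
  exact hs.eigenvalues_antitone hfr (Fin.mk_le_mk.2 (by omega : (i : ℕ) ≤ n - 1))

/-! ### Probability that a single column is short -/

theorem iIndepFun_curry {ι κ Ω S : Type*} [MeasurableSpace Ω] [MeasurableSpace S] {μ : Measure Ω}
    {X : ι → κ → Ω → S} (hX : ∀ i j, Measurable (X i j))
    (h : iIndepFun (fun (p : ι × κ) ω => X p.1 p.2 ω) μ) :
    iIndepFun (fun i ω j => X i j ω) μ := by
  have := h.isProbabilityMeasure
  have hp : ∀ i j, IsProbabilityMeasure (μ.map (X i j)) :=
    fun i j => Measure.isProbabilityMeasure_map (hX i j).aemeasurable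
  have hrow : ∀ i, μ.map (fun ω j => X i j ω) = Measure.infinitePi fun j => μ.map (X i j) := by
    intro i
    refine (iIndepFun_iff_map_fun_eq_infinitePi_map (hX i)).1 ?_
    exact h.precomp (g := fun j => (i, j)) (Prod.mk_right_injective i)
  rw [iIndepFun_iff_map_fun_eq_infinitePi_map (fun i => measurable_pi_lambda _ (hX i))]
  simp_rw [hrow]
  rw [← Measure.infinitePi_map_curry (fun i j => μ.map (X i j)),
    ← (iIndepFun_iff_map_fun_eq_infinitePi_map (fun p : ι × κ => hX p.1 p.2)).1 h]
  exact (Measure.map_map (MeasurableEquiv.curry ι κ S).measurable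
    (measurable_pi_lambda _ fun p : ι × κ => hX p.1 p.2)).symm

/-- Layer-cake formula: the tail probability is bounded by 1 up to `T₀`, by the power law up to `τ`,
and vanishes beyond. -/
theorem integral_sq_indicator_le {Ω : Type*} [MeasurableSpace Ω] {μ : Measure Ω}
    [IsProbabilityMeasure μ] {Y : Ω → ℝ} (hY : Measurable Y) {α Cu T₀ τ : ℝ} (hα₂ : α < 2)
    (hCu : 0 ≤ Cu) (hT₀ : 0 < T₀) (hτ : 0 < τ)
    (htail : ∀ t, T₀ ≤ t → μ.real {ω | t < |Y ω|} ≤ Cu * t ^ (-α)) :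
    ∫ ω, {x : ℝ | |x| ≤ τ}.indicator (fun x => x ^ 2) (Y ω) ∂μ ≤
      T₀ ^ 2 + 2 * Cu / (2 - α) * τ ^ (2 - α) := by
  set f : Ω → ℝ := fun ω => {x : ℝ | |x| ≤ τ}.indicator (fun x => |x|) (Y ω) with hf
  have hfm : Measurable f :=
    (measurable_abs.indicator (measurableSet_le measurable_abs measurable_const)).comp hY
  have hf0 : ∀ ω, 0 ≤ f ω := fun ω => Set.indicator_nonneg (fun _ _ => abs_nonneg _) _
  have hsq : ∀ ω, {x : ℝ | |x| ≤ τ}.indicator (fun x => x ^ 2) (Y ω) = f ω ^ (2 : ℝ) := by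
    intro ω
    simp only [hf, Set.indicator_apply]
    split_ifs <;> simp
  have hi1 : ∫⁻ t in Set.Ioc 0 T₀, ENNReal.ofReal t = ENNReal.ofReal (T₀ ^ 2 / 2) := by
    rw [← ofReal_integral_eq_lintegral_ofReal, ← intervalIntegral.integral_of_le hT₀.le]
    · simp
    · exact (intervalIntegrable_iff_integrableOn_Ioc_of_le hT₀.le).1
        intervalIntegral.intervalIntegrable_id
    · exact (ae_restrict_mem measurableSet_Ioc).mono fun t ht => ht.1.le
  have hi2 : ∫⁻ t in Set.Ioc 0 τ, ENNReal.ofReal (Cu * t ^ (1 - α)) =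
      ENNReal.ofReal (Cu / (2 - α) * τ ^ (2 - α)) := by
    rw [← ofReal_integral_eq_lintegral_ofReal, ← intervalIntegral.integral_of_le hτ.le]
    · rw [intervalIntegral.integral_const_mul, integral_rpow (Or.inl (by linarith))]
      rw [show 1 - α + 1 = 2 - α by ring, Real.zero_rpow (by linarith)]
      congr 1
      ring
    · exact (intervalIntegrable_iff_integrableOn_Ioc_of_le hτ.le).1
        ((intervalIntegral.intervalIntegrable_rpow' (by linarith)).const_mul _)
    · exact (ae_restrict_mem measurableSet_Ioc).mono fun t ht =>
        mul_nonneg hCu (Real.rpow_nonneg ht.1.le _)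
  have hpt : ∀ t ∈ Set.Ioi (0 : ℝ), μ {ω | t < f ω} * ENNReal.ofReal (t ^ ((2 : ℝ) - 1)) ≤
      (Set.Ioc 0 T₀).indicator (fun t => ENNReal.ofReal t) t +
        (Set.Ioc 0 τ).indicator (fun t => ENNReal.ofReal (Cu * t ^ (1 - α))) t := by
    intro t ht
    have ht : 0 < t := ht
    rw [show (2 : ℝ) - 1 = 1 by norm_num, Real.rpow_one]
    by_cases h1 : t ≤ T₀
    · rw [Set.indicator_of_mem (show t ∈ Set.Ioc 0 T₀ from ⟨ht, h1⟩)]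
      exact le_add_right (mul_le_of_le_one_left' prob_le_one)
    · by_cases h2 : t ≤ τ
      · rw [Set.indicator_of_mem (show t ∈ Set.Ioc 0 τ from ⟨ht, h2⟩)]
        refine le_add_left ?_
        have hle : μ {ω | t < f ω} ≤ ENNReal.ofReal (Cu * t ^ (-α)) := by
          refine (measure_mono fun ω (hω : t < f ω) => ?_).trans
            ((ENNReal.le_ofReal_iff_toReal_le (measure_ne_top μ _)
              (mul_nonneg hCu (Real.rpow_nonneg ht.le _))).2 (htail t (not_le.1 h1).le))
          exact hω.trans_le (Set.indicator_le_self' (fun _ _ => abs_nonneg _) _)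
        calc _ ≤ ENNReal.ofReal (Cu * t ^ (-α)) * ENNReal.ofReal t := by gcongr
          _ = _ := by
            rw [← ENNReal.ofReal_mul (mul_nonneg hCu (Real.rpow_nonneg ht.le _)), mul_assoc,
              ← Real.rpow_add_one ht.ne', show -α + 1 = 1 - α by ring]
      · have : {ω | t < f ω} = ∅ := by
          refine Set.eq_empty_of_forall_notMem fun ω (hω : t < f ω) => ?_
          have : f ω ≤ τ := Set.indicator_apply_le' (fun h => h) fun _ => hτ.le
          linarith
        simp [this]
  have hmain : ∫⁻ ω, ENNReal.ofReal (f ω ^ (2 : ℝ)) ∂μ ≤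
      ENNReal.ofReal (T₀ ^ 2 + 2 * Cu / (2 - α) * τ ^ (2 - α)) := by
    rw [lintegral_rpow_eq_lintegral_meas_lt_mul μ (ae_of_all _ hf0) hfm.aemeasurable two_pos]
    calc _ ≤ ENNReal.ofReal 2 * ∫⁻ t in Set.Ioi 0,
          ((Set.Ioc 0 T₀).indicator (fun t => ENNReal.ofReal t) t +
          (Set.Ioc 0 τ).indicator (fun t => ENNReal.ofReal (Cu * t ^ (1 - α))) t) := by
          gcongr ENNReal.ofReal 2 * ?_
          exact setLIntegral_mono' measurableSet_Ioi hpt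
      _ = ENNReal.ofReal 2 *
          (ENNReal.ofReal (T₀ ^ 2 / 2) + ENNReal.ofReal (Cu / (2 - α) * τ ^ (2 - α))) := by
          rw [lintegral_add_left (by fun_prop (disch := exact measurableSet_Ioc)),
            setLIntegral_indicator measurableSet_Ioc, setLIntegral_indicator measurableSet_Ioc,
            Set.inter_eq_left.2 Set.Ioc_subset_Ioi_self,
            Set.inter_eq_left.2 Set.Ioc_subset_Ioi_self, hi1, hi2]
      _ = _ := by
          rw [← ENNReal.ofReal_add (by positivity)
            (mul_nonneg (div_nonneg hCu (by linarith)) (by positivity)),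
            ← ENNReal.ofReal_mul (by norm_num)]
          congr 1
          ring
  simp_rw [hsq]
  rw [integral_eq_lintegral_of_nonneg_ae (ae_of_all _ fun ω => Real.rpow_nonneg (hf0 ω) _)
    (hfm.pow_const _).aestronglyMeasurable]
  exact ENNReal.toReal_le_of_le_ofReal (add_nonneg (sq_nonneg _)
    (mul_nonneg (div_nonneg (by linarith) (by linarith)) (by positivity))) hmain

/-- Markov's inequality restricted to the event that all `|Y i| ≤ τ`. By independence, that event
has probability `p ^ card ι`, and each square integrates over it to at most `m * p ^ (card ι - 1)`.
-/
theorem measureReal_sum_sq_lt_ge {ι Ω : Type*} [Fintype ι] [MeasurableSpace Ω] {μ : Measure Ω}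
    {Y : ι → Ω → ℝ} (hY : ∀ i, Measurable (Y i)) (hind : iIndepFun Y μ) {τ p m lam : ℝ}
    (hlam : 0 < lam) (hp : ∀ i, μ.real {ω | |Y i ω| ≤ τ} = p)
    (hm : ∀ i, ∫ ω, {x : ℝ | |x| ≤ τ}.indicator (fun x => x ^ 2) (Y i ω) ∂μ ≤ m) :
    p ^ Fintype.card ι - Fintype.card ι * (m * p ^ (Fintype.card ι - 1)) / lam ≤
      μ.real {ω | ∑ i, Y i ω ^ 2 < lam} := by
  classical
  have := hind.isProbabilityMeasure
  have hB : MeasurableSet {x : ℝ | |x| ≤ τ} := measurableSet_le measurable_abs measurable_const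
  set u : ℝ → ℝ := {x : ℝ | |x| ≤ τ}.indicator 1 with hu
  set v : ℝ → ℝ := {x : ℝ | |x| ≤ τ}.indicator (fun x => x ^ 2) with hv
  have hum : Measurable u := measurable_one.indicator hB
  have hvm : Measurable v := (measurable_id.pow_const 2).indicator hB
  have hu0 : ∀ x, 0 ≤ u x := fun x => Set.indicator_nonneg (fun _ _ => zero_le_one) x
  have hu1 : ∀ x, u x ≤ 1 := fun x => Set.indicator_le_self' (fun _ _ => zero_le_one) x
  have hvu : ∀ x, v x = x ^ 2 * u x := by
    intro x; simp only [hu, hv, Set.indicator_apply]; split_ifs <;> simp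
  have hvτ : ∀ x, |v x| ≤ τ ^ 2 := by
    intro x
    simp only [hv, Set.indicator_apply]
    split_ifs with h
    · rw [abs_of_nonneg (sq_nonneg x), ← sq_abs]
      exact pow_le_pow_left₀ (abs_nonneg x) h 2
    · simpa using sq_nonneg τ
  have hEu : ∀ i, ∫ ω, u (Y i ω) ∂μ = p := by
    intro i
    exact (integral_indicator_one ((hY i) hB)).trans (hp i)
  set A : Ω → ℝ := fun ω => ∏ i, u (Y i ω) with hA
  have hA0 : ∀ ω, 0 ≤ A ω := fun ω => Finset.prod_nonneg fun i _ => hu0 _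
  have hA1 : ∀ ω, A ω ≤ 1 := fun ω => Finset.prod_le_one (fun i _ => hu0 _) fun i _ => hu1 _
  have hAm : Measurable A := Finset.measurable_prod _ fun i _ => hum.comp (hY i)
  have hAint : Integrable A μ := by
    refine Integrable.of_bound hAm.aestronglyMeasurable 1 (ae_of_all _ fun ω => ?_)
    rw [Real.norm_of_nonneg (hA0 ω)]
    exact hA1 ω
  have hEA : ∫ ω, A ω ∂μ = p ^ Fintype.card ι := by
    rw [hind.integral_fun_prod_comp (f := fun _ => u) (fun i => (hY i).aemeasurable)
      fun i => hum.aestronglyMeasurable]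
    simp [hEu]
  -- The square is absorbed into the `i`-th factor, so the product form needed for independence
  -- survives.
  have hprod : ∀ i ω, Y i ω ^ 2 * A ω = ∏ k, (Function.update (fun _ => u) i v) k (Y k ω) := by
    intro i ω
    rw [hA]
    simp only
    rw [← Finset.mul_prod_erase _ _ (Finset.mem_univ i),
      ← Finset.mul_prod_erase _ (fun k => Function.update (fun _ => u) i v k (Y k ω))
        (Finset.mem_univ i), Function.update_self, hvu, mul_assoc]
    congr 2
    refine Finset.prod_congr rfl fun k hk => ?_
    rw [Function.update_of_ne (Finset.ne_of_mem_erase hk)]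
  have hEi : ∀ i, ∫ ω, Y i ω ^ 2 * A ω ∂μ ≤ m * p ^ (Fintype.card ι - 1) := by
    intro i
    simp_rw [hprod i]
    rw [hind.integral_fun_prod_comp (f := Function.update (fun _ => u) i v)
      (fun i => (hY i).aemeasurable)]
    · rw [← Finset.mul_prod_erase _ _ (Finset.mem_univ i), Function.update_self]
      rw [Finset.prod_congr rfl (g := fun _ => p) fun k hk => by
        rw [Function.update_of_ne (Finset.ne_of_mem_erase hk), hEu]]
      rw [Finset.prod_const, Finset.card_erase_of_mem (Finset.mem_univ i), Finset.card_univ]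
      exact mul_le_mul_of_nonneg_right (hm i) (pow_nonneg (hp i ▸ measureReal_nonneg) _)
    · intro k
      by_cases hk : k = i
      · subst hk; simpa using hvm.aestronglyMeasurable
      · simpa [Function.update_of_ne hk] using hum.aestronglyMeasurable
  have hint : ∀ i, Integrable (fun ω => Y i ω ^ 2 * A ω) μ := by
    intro i
    refine Integrable.of_bound (((hY i).pow_const 2).mul hAm).aestronglyMeasurable (τ ^ 2)
      (ae_of_all _ fun ω => ?_)
    have : Y i ω ^ 2 * A ω = v (Y i ω) * ∏ k ∈ Finset.univ.erase i, u (Y k ω) := by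
      rw [hvu, mul_assoc, Finset.mul_prod_erase _ (fun k => u (Y k ω)) (Finset.mem_univ i)]
    rw [this, Real.norm_eq_abs, abs_mul]
    refine (mul_le_mul (hvτ _) ?_ (abs_nonneg _) (sq_nonneg _)).trans_eq (mul_one _)
    rw [abs_of_nonneg (Finset.prod_nonneg fun k _ => hu0 _)]
    exact Finset.prod_le_one (fun k _ => hu0 _) fun k _ => hu1 _
  have hS : MeasurableSet {ω | ∑ i, Y i ω ^ 2 < lam} :=
    measurableSet_lt (Finset.measurable_sum _ fun i _ => (hY i).pow_const 2) measurable_const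
  have hpt : ∀ ω, A ω - (∑ i, Y i ω ^ 2 * A ω) / lam ≤
      {ω | ∑ i, Y i ω ^ 2 < lam}.indicator (1 : Ω → ℝ) ω := by
    intro ω
    have hs : 0 ≤ ∑ i, Y i ω ^ 2 := Finset.sum_nonneg fun i _ => sq_nonneg _
    rw [← Finset.sum_mul, Set.indicator_apply]
    split_ifs with h
    · have : 0 ≤ (∑ i, Y i ω ^ 2) * A ω / lam :=
        div_nonneg (mul_nonneg hs (hA0 ω)) hlam.le
      have := hA1 ω
      simp only [Pi.one_apply]
      linarith
    · have h : lam ≤ ∑ i, Y i ω ^ 2 := not_lt.1 h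
      rw [sub_nonpos, le_div_iff₀ hlam, mul_comm]
      exact mul_le_mul_of_nonneg_right h (hA0 ω)
  have hsumint : Integrable (fun ω => (∑ i, Y i ω ^ 2 * A ω) / lam) μ :=
    (integrable_finsetSum _ fun i _ => hint i).div_const _
  calc _ ≤ ∫ ω, (A ω - (∑ i, Y i ω ^ 2 * A ω) / lam) ∂μ := by
        rw [integral_sub hAint hsumint, hEA, integral_div, integral_finsetSum _ fun i _ => hint i]
        gcongr
        refine (Finset.sum_le_sum fun i _ => hEi i).trans_eq ?_
        simp
    _ ≤ ∫ ω, {ω | ∑ i, Y i ω ^ 2 < lam}.indicator (1 : Ω → ℝ) ω ∂μ :=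
        integral_mono (hAint.sub hsumint) ((integrable_const (1 : ℝ)).indicator hS) hpt
    _ = _ := integral_indicator_one hS

theorem exp_neg_two_mul_le_one_sub {q : ℝ} (hq0 : 0 ≤ q) (hq : q ≤ 1 / 2) :
    Real.exp (-(2 * q)) ≤ 1 - q := by
  have h : 0 < 1 - q := by linarith
  rw [← Real.le_log_iff_exp_le h]
  refine le_trans ?_ (Real.one_sub_inv_le_log_of_pos h)
  have : (1 - q)⁻¹ ≤ 1 + 2 * q := by
    rw [inv_le_iff_one_le_mul₀ h]
    nlinarith
  linarith

theorem exp_div_two_le_measureReal_sum_sq_lt {ι Ω : Type*} [Fintype ι] [Nonempty ι]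
    [MeasurableSpace Ω] {μ : Measure Ω} {Y : ι → Ω → ℝ} (hY : ∀ i, Measurable (Y i))
    (hind : iIndepFun Y μ) (hid : ∀ i j, IdentDistrib (Y i) (Y j) μ μ) {α Cu T₀ τ : ℝ}
    (hα₂ : α < 2) (hCu : 0 < Cu) (hT₀ : 0 < T₀) (hτ : T₀ ≤ τ)
    (htail : ∀ i t, T₀ ≤ t → μ.real {ω | t < |Y i ω|} ≤ Cu * t ^ (-α))
    (hT : T₀ ^ 2 ≤ 2 * Cu / (2 - α) * τ ^ (2 - α)) (hq : Cu * τ ^ (-α) ≤ 1 / 2) :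
    Real.exp (-(2 * (Cu * τ ^ (-α)))) ^ Fintype.card ι / 2 ≤
      μ.real {ω | ∑ i, Y i ω ^ 2 <
        4 * Fintype.card ι * (4 * Cu / (2 - α) * τ ^ (2 - α))} := by
  have := hind.isProbabilityMeasure
  have hτ0 : 0 < τ := hT₀.trans_le hτ
  obtain ⟨i₀⟩ := ‹Nonempty ι›
  have hN : 0 < Fintype.card ι := Fintype.card_pos_iff.2 ⟨i₀⟩
  set N := Fintype.card ι
  set p := μ.real {ω | |Y i₀ ω| ≤ τ} with hp
  set m := 4 * Cu / (2 - α) * τ ^ (2 - α) with hm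
  have hm0 : 0 < m := mul_pos (div_pos (by linarith) (by linarith)) (Real.rpow_pos_of_pos hτ0 _)
  have hlam : 0 < 4 * N * m := by positivity
  have hB : MeasurableSet {x : ℝ | |x| ≤ τ} := measurableSet_le measurable_abs measurable_const
  have hpi : ∀ i, μ.real {ω | |Y i ω| ≤ τ} = p := fun i =>
    congrArg ENNReal.toReal ((hid i i₀).measure_mem_eq hB)
  have hpq : 1 - Cu * τ ^ (-α) ≤ p := by
    have h1 := probReal_compl_eq_one_sub (μ := μ) (hY i₀ hB)
    have h2 : (Y i₀ ⁻¹' {x : ℝ | |x| ≤ τ})ᶜ = {ω | τ < |Y i₀ ω|} := by ext; simp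
    have h3 := htail i₀ τ hτ
    rw [h2] at h1
    have h4 : μ.real (Y i₀ ⁻¹' {x : ℝ | |x| ≤ τ}) = p := rfl
    linarith
  have hp2 : 1 / 2 ≤ p := by linarith
  have key := measureReal_sum_sq_lt_ge hY hind hlam hpi (m := m) fun i => by
    refine (integral_sq_indicator_le (hY i) hα₂ hCu.le hT₀ hτ0 (htail i)).trans ?_
    rw [hm]
    have : 4 * Cu / (2 - α) * τ ^ (2 - α) = 2 * Cu / (2 - α) * τ ^ (2 - α) +
        2 * Cu / (2 - α) * τ ^ (2 - α) := by ring
    linarith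
  refine le_trans ?_ key
  have hpow : p ^ N = p ^ (N - 1) * p := by rw [← pow_succ, Nat.sub_add_cancel hN]
  have hexp : Real.exp (-(2 * (Cu * τ ^ (-α)))) ^ N ≤ p ^ N :=
    pow_le_pow_left₀ (Real.exp_pos _).le
      ((exp_neg_two_mul_le_one_sub (by positivity) hq).trans hpq) _
  have hdiv : N * (m * p ^ (N - 1)) / (4 * N * m) = p ^ (N - 1) / 4 := by
    field_simp
  -- The factor 4 in the threshold makes the Markov loss `p ^ (N - 1) / 4`, at most half of `p ^ N`
  -- as `p ≥ 1 / 2`.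
  have : 0 ≤ p ^ (N - 1) * (p - 1 / 2) := mul_nonneg (by positivity) (by linarith)
  rw [hdiv]
  nlinarith

/-! ### All columns at once, and asymptotics in `N` -/

theorem measureReal_forall_sum_sq_ge_le {N n : ℕ} {Ω : Type*} [MeasurableSpace Ω] {μ : Measure Ω}
    {X : Ω → Matrix (Fin N) (Fin n) ℝ} (hX : ∀ i j, Measurable fun ω => X ω i j)
    (hind : iIndepFun (fun (p : Fin N × Fin n) (ω : Ω) => X ω p.1 p.2) μ) {lam δ : ℝ}
    (hδ : ∀ j, δ ≤ μ.real {ω | ∑ i, X ω i j ^ 2 < lam}) :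
    μ.real {ω | ∀ j, lam ≤ ∑ i, X ω i j ^ 2} ≤ Real.exp (-(n * δ)) := by
  have := hind.isProbabilityMeasure
  have hcols : iIndepFun (fun j ω i => X ω i j) μ :=
    iIndepFun_curry (X := fun j i ω => X ω i j) (fun j i => hX i j)
      (hind.precomp (g := Prod.swap) Prod.swap_injective)
  have hB : MeasurableSet {x : Fin N → ℝ | lam ≤ ∑ i, x i ^ 2} :=
    measurableSet_le measurable_const (by fun_prop)
  have hset : {ω | ∀ j, lam ≤ ∑ i, X ω i j ^ 2} =
      ⋂ j, (fun ω i => X ω i j) ⁻¹' {x : Fin N → ℝ | lam ≤ ∑ i, x i ^ 2} := by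
    ext; simp
  have hprod := hcols.meas_iInter
    (s := fun j => (fun ω i => X ω i j) ⁻¹' {x : Fin N → ℝ | lam ≤ ∑ i, x i ^ 2})
    fun j => ⟨_, hB, rfl⟩
  rw [measureReal_def, hset, hprod, ENNReal.toReal_prod]
  have hj : ∀ j, (μ ((fun ω i => X ω i j) ⁻¹' {x : Fin N → ℝ | lam ≤ ∑ i, x i ^ 2})).toReal ≤
      Real.exp (-δ) := by
    intro j
    have hm : Measurable fun ω i => X ω i j := measurable_pi_lambda _ fun i => hX i j
    have h1 := probReal_compl_eq_one_sub (μ := μ) (hm hB)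
    have h2 : ((fun ω i => X ω i j) ⁻¹' {x : Fin N → ℝ | lam ≤ ∑ i, x i ^ 2})ᶜ =
        {ω | ∑ i, X ω i j ^ 2 < lam} := by ext; simp
    rw [h2] at h1
    have h3 := hδ j
    have h4 := Real.one_sub_le_exp_neg δ
    rw [← measureReal_def]
    linarith
  refine (Finset.prod_le_prod (fun _ _ => ENNReal.toReal_nonneg) fun j _ => hj j).trans_eq ?_
  rw [Finset.prod_const, ← Real.exp_nat_mul]
  simp

theorem eventually_log_le_mul {ε : ℝ} (hε : 0 < ε) :
    ∀ᶠ N : ℕ in Filter.atTop, Real.log N ≤ ε * N := by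
  have h := tendsto_natCast_atTop_atTop.eventually (Real.isLittleO_log_id_atTop.bound hε)
  filter_upwards [h] with N hN
  simpa using (le_abs_self _).trans hN

theorem eventually_exp_neg_mul_rpow_le {b c K : ℝ} (hb : 0 < b) (hc : 0 < c) (hK : 0 < K) :
    ∀ᶠ N : ℕ in Filter.atTop, Real.exp (-(c * (N : ℝ) ^ b)) ≤ (N : ℝ) ^ (-K) := by
  have h := tendsto_natCast_atTop_atTop.eventually
    ((isLittleO_log_rpow_atTop hb).bound (div_pos hc hK))
  filter_upwards [h, Filter.eventually_gt_atTop 0] with N hN hN0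
  have hN0 : (0 : ℝ) < N := Nat.cast_pos.2 hN0
  rw [Real.norm_of_nonneg (Real.rpow_nonneg hN0.le b), div_mul_eq_mul_div,
    le_div_iff₀ hK] at hN
  rw [Real.rpow_def_of_pos hN0 (-K), Real.exp_le_exp]
  have := mul_le_mul_of_nonneg_right (Real.le_norm_self (Real.log N)) hK.le
  linarith

/-- The level tends to infinity with `N`. The second bound lets the `T₀ ^ 2` term of the truncated
moment be absorbed, which keeps `C` independent of `T₀`. -/
theorem eventually_truncation_level {α D A T₀ : ℝ} (hα₀ : 0 < α) (hα₂ : α < 2) (hD : 0 < D)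
    (hA : 0 < A) (hT₀ : 0 < T₀) :
    ∀ᶠ N : ℕ in Filter.atTop, T₀ ≤ (A * N / Real.log N) ^ (1 / α) ∧
      T₀ ^ 2 ≤ D * ((A * N / Real.log N) ^ (1 / α)) ^ (2 - α) := by
  set R := max T₀ ((T₀ ^ 2 / D) ^ (1 / (2 - α))) with hR
  have hR0 : 0 < R := hT₀.trans_le (le_max_left _ _)
  have hRα : 0 < R ^ α := Real.rpow_pos_of_pos hR0 α
  filter_upwards [eventually_log_le_mul (div_pos hA hRα), Filter.eventually_ge_atTop 2]
    with N hN hN2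
  have hL : 0 < Real.log N := Real.log_pos (by exact_mod_cast hN2)
  have hRle : R ≤ (A * N / Real.log N) ^ (1 / α) := by
    rw [one_div, Real.le_rpow_inv_iff_of_pos hR0.le (by positivity) hα₀, le_div_iff₀ hL]
    rwa [div_mul_eq_mul_div, le_div_iff₀ hRα, mul_comm] at hN
  refine ⟨(le_max_left _ _).trans hRle, ?_⟩
  have h2 : 0 < 2 - α := by linarith
  have h := (le_max_right _ _).trans hRle
  rw [one_div (2 - α), Real.rpow_inv_le_iff_of_pos (by positivity) (by positivity) h2,
    div_le_iff₀ hD] at h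
  linarith

theorem mainTheorem4 (α : ℝ) (hα₀ : 0 < α) (hα₂ : α < 2) (a : ℝ) (ha : 1 < a)
    (Cu : ℝ) (hCu : 0 < Cu) (K : ℝ) (hK : 0 < K) :
    ∃ C : ℝ, 0 < C ∧
      ∀ Cl T₀ : ℝ, 0 < Cl → 0 < T₀ →
        ∃ M : ℝ, 0 < M ∧
          ∀ (Ω : Type*) [MeasurableSpace Ω] (μ : Measure Ω) [IsProbabilityMeasure μ]
            (N n : ℕ) (X : Ω → Matrix (Fin N) (Fin n) ℝ),
            1 ≤ n → IsHeavyTailedMatrix μ a α Cl Cu T₀ X →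
              μ.real {ω | C * (N : ℝ) ^ (1 / α) * Real.log N ^ ((α - 2) / (2 * α)) ≤
                  smallestSingularValue (X ω)} ≤ M * (N : ℝ) ^ (-K) := by
  have h2 : 0 < 2 - α := by linarith
  have hC2 : 0 < 4 * (4 * Cu / (2 - α)) * (8 * Cu) ^ ((2 - α) / α) := by positivity
  refine ⟨√(4 * (4 * Cu / (2 - α)) * (8 * Cu) ^ ((2 - α) / α)), Real.sqrt_pos.2 hC2,
    fun Cl T₀ _ hT₀ => ?_⟩
  obtain ⟨N₀, hN₀⟩ := Filter.eventually_atTop.1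
    (((eventually_truncation_level hα₀ hα₂ (D := 2 * Cu / (2 - α)) (A := 8 * Cu) (by positivity)
      (by positivity) hT₀).and (eventually_log_le_mul (ε := 4) (by norm_num))).and
      -- From `N ≤ 2 * a * n`: `n * N ^ (-1/4) / 2 ≥ N ^ (3/4) / (4 * a)`.
      (eventually_exp_neg_mul_rpow_le (b := 3 / 4) (c := 1 / (4 * a)) (K := K) (by norm_num)
        (by positivity) hK))
  -- This `M` makes the bound exceed 1 when `N < N₀`.
  refine ⟨((N₀ : ℝ) + 1) ^ K, by positivity, ?_⟩
  intro Ω _ μ _ N n X hn hX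
  have hn' : (1 : ℝ) ≤ n := by exact_mod_cast hn
  have hNgt : (1 : ℝ) < N := by
    rw [hX.rows]
    exact (by nlinarith : (1 : ℝ) < a * n).trans_le (Nat.le_ceil _)
  have hNn : (N : ℝ) ≤ 2 * a * n := by
    have := Nat.ceil_lt_add_one (show 0 ≤ a * (n : ℝ) by positivity)
    rw [← hX.rows] at this
    nlinarith
  have hN0 : (0 : ℝ) < N := by linarith
  rcases lt_or_ge N N₀ with hlt | hge
  · refine measureReal_le_one.trans ?_
    rw [Real.rpow_neg hN0.le, ← div_eq_mul_inv, one_le_div (by positivity)]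
    refine Real.rpow_le_rpow hN0.le ?_ hK.le
    have : (N : ℝ) ≤ N₀ := by exact_mod_cast hlt.le
    linarith
  obtain ⟨⟨⟨hτ, hT⟩, hlog⟩, hexp⟩ := hN₀ N hge
  have hL : 0 < Real.log N := Real.log_pos hNgt
  set L := Real.log N with hLdef
  have hQ : 0 < 8 * Cu * N / L := by positivity
  -- The 8 gives `exp (-2 * L / (8 * N)) ^ N = N ^ (-1/4)`; any exponent in `(-1, 0)` would do.
  set τ := (8 * Cu * N / L) ^ (1 / α) with hτdef
  have hτα : Cu * τ ^ (-α) = L / (8 * N) := by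
    rw [hτdef, ← Real.rpow_mul hQ.le, show 1 / α * -α = -1 by field_simp, Real.rpow_neg_one]
    field_simp
  have hNpos : 0 < N := by exact_mod_cast hN0
  have : Nonempty (Fin N) := ⟨⟨0, hNpos⟩⟩
  have hlam : 4 * N * (4 * Cu / (2 - α) * τ ^ (2 - α)) =
      (√(4 * (4 * Cu / (2 - α)) * (8 * Cu) ^ ((2 - α) / α)) * (N : ℝ) ^ (1 / α) *
        L ^ ((α - 2) / (2 * α))) ^ 2 := by
    rw [mul_pow, mul_pow, Real.sq_sqrt hC2.le, ← Real.rpow_mul_natCast hN0.le,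
      ← Real.rpow_mul_natCast hL.le, hτdef, ← Real.rpow_mul hQ.le,
      show 1 / α * (2 - α) = (2 - α) / α by ring, Real.div_rpow (by positivity) hL.le,
      Real.mul_rpow (by positivity) hN0.le,
      show (α - 2) / (2 * α) * ((2 : ℕ) : ℝ) = -((2 - α) / α) by push_cast; field_simp; ring,
      Real.rpow_neg hL.le,
      show 1 / α * ((2 : ℕ) : ℝ) = (2 - α) / α + 1 by push_cast; field_simp; ring,
      Real.rpow_add_one hN0.ne']
    ring
  have hδ : ∀ j, (N : ℝ) ^ (-(1 / 4) : ℝ) / 2 ≤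
      μ.real {ω | ∑ i, X ω i j ^ 2 < 4 * N * (4 * Cu / (2 - α) * τ ^ (2 - α))} := by
    intro j
    have h := exp_div_two_le_measureReal_sum_sq_lt (Y := fun i ω => X ω i j)
      (fun i => hX.measurable i j)
      (hX.indep.precomp (g := fun i => (i, j)) (Prod.mk_left_injective j))
      (fun i i' => hX.identDistrib i j i' j) hα₂ hCu hT₀ hτ
      (fun i t ht => (hX.tail i j t ht).2) hT
      (by rw [hτα, div_le_iff₀ (by positivity)]; linarith)
    rw [Fintype.card_fin] at h
    refine le_trans (le_of_eq ?_) h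
    rw [hτα, ← Real.exp_nat_mul, Real.rpow_def_of_pos hN0, ← hLdef]
    congr 2
    field_simp
    norm_num
  refine (measureReal_mono fun ω hω j => ?_).trans
    ((measureReal_forall_sum_sq_ge_le hX.measurable hX.indep hδ).trans ?_)
  · rw [hlam]
    exact (pow_le_pow_left₀ (by positivity) hω 2).trans
      (sq_smallestSingularValue_le_column (X ω) j)
  · have h1 : Real.exp (-(n * ((N : ℝ) ^ (-(1 / 4) : ℝ) / 2))) ≤ (N : ℝ) ^ (-K) := by
      refine le_trans (Real.exp_le_exp.2 (neg_le_neg ?_)) hexp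
      have hpow : (N : ℝ) ^ (3 / 4 : ℝ) = N * (N : ℝ) ^ (-(1 / 4) : ℝ) := by
        rw [mul_comm, ← Real.rpow_add_one hN0.ne']
        norm_num
      rw [hpow, one_div_mul_eq_div, div_le_iff₀ (by positivity)]
      have := mul_le_mul_of_nonneg_right hNn (Real.rpow_nonneg hN0.le (-(1 / 4) : ℝ))
      linarith
    refine h1.trans (le_mul_of_one_le_left (Real.rpow_nonneg hN0.le _) ?_)
    exact Real.one_le_rpow (by linarith [Nat.cast_nonneg (α := ℝ) N₀]) hK.le
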